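/- Let $K$ be a (possibly disconnected) compact Lie group and let $\Gamma$ be a finitely generated nilpotent group. Equip the set $\mathrm{Hom}(\Gamma,K)$ of group homomorphisms with the topology of pointwise convergence (equivalently, the subspace topology from $K^n$ given by evaluating at any $n$ generators of $\Gamma$), and let $\mathrm{Hom}(\Gamma,K)_{\mathbb 1}$ denote the connected component of the trivial representation. Let $r=\operatorname{rank} H_1(\Gamma;\mathbb Z)$, where $H_1(\Gamma;\mathbb Z)=\Gamma/[\Gamma,\Gamma]$. Then there is a homeomorphism $$\mathrm{Hom}(\Gamma,K)_{\mathbb 1}\cong \mathrm{Hom}(\mathbb Z^{r},K)_{\mathbb 1}.$$ Moreover, the torsion part of the abelianization acts trivially on the trivial component: if $\rho\in\mathrm{Hom}(\Gamma,K)_{\mathbb 1}$ and $\gamma\in\Gamma$ has image of finite order in $\Gamma/[\Gamma,\Gamma]$, then $\rho(\gamma)=1$. -/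

import Mathlib

open scoped Manifold ContDiff

/-- The representation space `Hom(Γ, K)`: the set of all group homomorphisms `Γ → K`. -/
def RepSpace (Γ K : Type*) [Group Γ] [Group K] : Type _ := Γ →* K

namespace RepSpace

variable {Γ K : Type*} [Group Γ] [Group K]

instance : FunLike (RepSpace Γ K) Γ K := inferInstanceAs (FunLike (Γ →* K) Γ K)

instance : MonoidHomClass (RepSpace Γ K) Γ K :=
  inferInstanceAs (MonoidHomClass (Γ →* K) Γ K)

/-- The topology of pointwise convergence: `Hom(Γ, K)` is a subspace of the product `K ^ Γ`.
For generators `γ₁, …, γₙ` of `Γ` it is the subspace topology from `ρ ↦ (ρ γ₁, …, ρ γₙ) ∈ K ^ n`;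
see `isInducing_eval_generators`. -/
instance [TopologicalSpace K] : TopologicalSpace (RepSpace Γ K) :=
  TopologicalSpace.induced (fun (ρ : RepSpace Γ K) (γ : Γ) => ρ γ) inferInstance

/-- The trivial representation. -/
instance : One (RepSpace Γ K) := inferInstanceAs (One (Γ →* K))

theorem isInducing_eval_generators [TopologicalSpace K] [IsTopologicalGroup K]
    {n : ℕ} (g : Fin n → Γ) (hg : Subgroup.closure (Set.range g) = ⊤) :
    Topology.IsInducing (fun (ρ : RepSpace Γ K) (i : Fin n) => ρ (g i)) := by
  refine ⟨le_antisymm ?_ ?_⟩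
  · refine continuous_iff_le_induced.mp (continuous_pi fun i => ?_)
    exact (continuous_apply (g i)).comp continuous_induced_dom
  · let t : TopologicalSpace (RepSpace Γ K) :=
      TopologicalSpace.induced (fun (ρ : RepSpace Γ K) (i : Fin n) => ρ (g i)) inferInstance
    refine continuous_iff_le_induced.mp (continuous_pi fun γ => ?_)
    have hγ : γ ∈ Subgroup.closure (Set.range g) := hg ▸ Subgroup.mem_top γ
    induction hγ using Subgroup.closure_induction with
    | mem x hx =>
      obtain ⟨i, rfl⟩ := hx
      have h : Continuous (fun (ρ : RepSpace Γ K) (i : Fin n) => ρ (g i)) :=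
        continuous_induced_dom
      exact continuous_pi_iff.mp h i
    | one => simpa only [map_one] using continuous_const
    | mul x y _ _ hx hy => exact (hx.mul hy).congr fun ρ => (map_mul ρ x y).symm
    | inv x _ hx => exact hx.inv.congr fun ρ => (map_inv ρ x).symm

variable (Γ K) in
/-- `Hom(Γ, K)_𝟙`: the connected component of the trivial representation. -/
def trivialComponent [TopologicalSpace K] : Set (RepSpace Γ K) :=
  connectedComponent 1

end RepSpace

/-- The first integral homology `H₁(Γ; ℤ) = Γ / [Γ, Γ]`, written additively. -/
abbrev IntegralH1 (Γ : Type*) [Group Γ] : Type _ := Additive (Abelianization Γ)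

open Topology Filter
open scoped commutatorElement

/-! Suppose `⁅x, y⁆` commutes with `x` and `y` in a compact group without small powers. Then `⁅x, y⁆
^ (n * j) = ⁅x ^ n, y ^ j⁆`, which is small for every `j` once `x ^ n` is near `1`, so `⁅x, y⁆ ^ n =
1`. Compactness makes the exponent uniform (`HasNoSmallPowers.exists_commutatorElement_pow_eq_one`).
As `1` is isolated among elements of bounded exponent, evaluations with such values are constant on
the trivial component (`eq_one_of_forall_pow_eq_one`).

Climbing the lower central series from its trivial term, where each commutator becomes central in
the image, kills `[Γ, Γ]`; the same isolation then kills torsion in the abelianization. Hence the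
component factors through `Γ → ℤ ^ r`. -/

/-- A topological monoid has no small powers if some neighbourhood of `1` contains all the powers
of no element other than `1`. -/
def HasNoSmallPowers (G : Type*) [TopologicalSpace G] [Monoid G] : Prop :=
  ∃ V ∈ 𝓝 (1 : G), ∀ x : G, (∀ n : ℕ, x ^ n ∈ V) → x = 1

/-! ### Lie groups have no small powers -/

section LieGroup

variable {E : Type*} [NormedAddCommGroup E] [NormedSpace ℝ E]
  {K : Type*} [TopologicalSpace K] [ChartedSpace E K] [Group K] [LieGroup 𝓘(ℝ, E) ∞ K]

/-- The derivative of `x ↦ x * x` at the identity of a Lie group is multiplication by `2`. -/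
theorem hasMFDerivAt_mul_self_one :
    HasMFDerivAt 𝓘(ℝ, E) 𝓘(ℝ, E) (fun x : K => x * x) 1
      ((2 : ℝ) • ContinuousLinearMap.id ℝ E : E →L[ℝ] E) := by
  have hm : MDifferentiableAt (𝓘(ℝ, E).prod 𝓘(ℝ, E)) 𝓘(ℝ, E)
      (fun p : K × K => p.1 * p.2) (1, 1) :=
    (contMDiff_mul 𝓘(ℝ, E) ∞ (G := K)).mdifferentiableAt (by simp)
  have hd : HasMFDerivAt 𝓘(ℝ, E) (𝓘(ℝ, E).prod 𝓘(ℝ, E)) (fun x : K => (x, x)) 1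
      ((ContinuousLinearMap.id ℝ E).prod (ContinuousLinearMap.id ℝ E)) :=
    (hasMFDerivAt_id (I := 𝓘(ℝ, E)) (1 : K)).prodMk (hasMFDerivAt_id (I := 𝓘(ℝ, E)) (1 : K))
  have h := HasMFDerivAt.comp (f := fun x : K => (x, x)) (g := fun p : K × K => p.1 * p.2) (1 : K) hm.hasMFDerivAt hd
  suffices hD : ((2 : ℝ) • ContinuousLinearMap.id ℝ E : E →L[ℝ] E) =
      (mfderiv (𝓘(ℝ, E).prod 𝓘(ℝ, E)) 𝓘(ℝ, E) (fun p : K × K => p.1 * p.2) (1, 1)).comp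
        ((ContinuousLinearMap.id ℝ E).prod (ContinuousLinearMap.id ℝ E)) by
    rw [hD]
    exact h
  ext v
  have h2 := mfderiv_prod_eq_add_apply (v := (v, v)) hm
  have d1 : HasMFDerivAt 𝓘(ℝ, E) 𝓘(ℝ, E) (fun z : K => z * 1) 1 (ContinuousLinearMap.id ℝ E) :=
    (hasMFDerivAt_id (1 : K)).congr_of_eventuallyEq (.of_forall mul_one)
  have d2 : HasMFDerivAt 𝓘(ℝ, E) 𝓘(ℝ, E) (fun z : K => 1 * z) 1 (ContinuousLinearMap.id ℝ E) :=
    (hasMFDerivAt_id (1 : K)).congr_of_eventuallyEq (.of_forall one_mul)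
  rw [d1.mfderiv, d2.mfderiv] at h2
  refine Eq.trans ?_ h2.symm
  exact two_smul ℝ v

/-- A Lie group has no small powers: in a chart, squaring moves points near the identity away
from it by a factor of at least `3 / 2`. -/
theorem hasNoSmallPowers_of_lieGroup (E : Type*) [NormedAddCommGroup E] [NormedSpace ℝ E]
    {K : Type*} [TopologicalSpace K] [ChartedSpace E K] [Group K] [LieGroup 𝓘(ℝ, E) ∞ K] :
    HasNoSmallPowers K := by
  let φ := extChartAt 𝓘(ℝ, E) (1 : K)
  have hF := (hasMFDerivAt_mul_self_one (E := E) (K := K)).2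
  simp only [modelWithCornersSelf_coe, Set.range_id] at hF
  -- An error of `1 / 2` against the derivative `2` leaves the growth factor `3 / 2`.
  have hlo := (hasFDerivAt_iff_isLittleO.mp (hasFDerivWithinAt_univ.mp hF)).def (c := 1 / 2) (by norm_num)
  have hφ : ContinuousAt φ 1 := continuousAt_extChartAt (I := 𝓘(ℝ, E)) (1 : K)
  have hsrc : ∀ᶠ x in 𝓝 (1 : K), x ∈ φ.source := extChartAt_source_mem_nhds (I := 𝓘(ℝ, E)) (1 : K)
  have hone : (1 : K) ∈ φ.source := mem_extChartAt_source (I := 𝓘(ℝ, E)) (1 : K)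
  have hball : ∀ᶠ x in 𝓝 (1 : K), ‖φ x - φ 1‖ < 1 := by
    have := hφ.eventually (Metric.ball_mem_nhds (φ 1) one_pos)
    simpa [dist_eq_norm] using this
  have hgrow : ∀ᶠ x in 𝓝 (1 : K), 3 / 2 * ‖φ x - φ 1‖ ≤ ‖φ (x * x) - φ 1‖ := by
    filter_upwards [hφ.eventually hlo, hsrc] with x hx hxs
    have hw : ∀ y ∈ φ.source, writtenInExtChartAt 𝓘(ℝ, E) 𝓘(ℝ, E) (1 : K)
        (fun x : K => x * x) (φ y) = φ (y * y) := by
      intro y hy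
      have e : (extChartAt 𝓘(ℝ, E) (1 : K)).symm (φ y) = y := φ.left_inv hy
      simp only [writtenInExtChartAt, Function.comp_apply, e, mul_one, φ]
    have h1 := hw 1 hone
    rw [mul_one] at h1
    change ‖writtenInExtChartAt 𝓘(ℝ, E) 𝓘(ℝ, E) (1 : K) (fun x : K => x * x) (φ x)
      - writtenInExtChartAt 𝓘(ℝ, E) 𝓘(ℝ, E) (1 : K) (fun x : K => x * x) (φ 1)
      - (2 : ℝ) • (φ x - φ 1)‖ ≤ 1 / 2 * ‖φ x - φ 1‖ at hx
    rw [hw x hxs, h1] at hx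
    have h2 : ‖(2 : ℝ) • (φ x - φ 1)‖ = 2 * ‖φ x - φ 1‖ := by simp [norm_smul]
    have h3 := norm_sub_norm_le ((2 : ℝ) • (φ x - φ 1)) (φ (x * x) - φ 1)
    rw [norm_sub_rev ((2 : ℝ) • (φ x - φ 1))] at h3
    linarith
  refine ⟨_, (hsrc.and (hball.and hgrow)), fun x hx => ?_⟩
  have hpow : ∀ n : ℕ, (3 / 2 : ℝ) ^ n * ‖φ x - φ 1‖ ≤ ‖φ (x ^ 2 ^ n) - φ 1‖ := by
    intro n
    induction n with
    | zero => simp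
    | succ n ih =>
      have h := (hx (2 ^ n)).2.2
      rw [← pow_add, ← two_mul, ← pow_succ'] at h
      rw [pow_succ']
      linarith
  have hzero : ‖φ x - φ 1‖ = 0 := by
    by_contra hne
    have hpos : 0 < ‖φ x - φ 1‖ := lt_of_le_of_ne (norm_nonneg _) (Ne.symm hne)
    obtain ⟨n, hn⟩ := pow_unbounded_of_one_lt (1 / ‖φ x - φ 1‖) (by norm_num : (1 : ℝ) < 3 / 2)
    rw [div_lt_iff₀ hpos] at hn
    exact absurd (hn.trans_le (hpow n)) (not_lt.mpr (hx (2 ^ n)).2.1.le)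
  have hxs : x ∈ φ.source := by simpa using (hx 1).1
  exact φ.injOn hxs hone (sub_eq_zero.mp (norm_eq_zero.mp hzero))

end LieGroup

/-! ### Powers of central commutators -/

section Commutator

variable {G : Type*} [Group G]

/-- Conjugation by `x` sends `y` to `⁅x, y⁆ * y`, whose powers split because the factors commute. -/
theorem commutatorElement_pow_right {x y : G} (h : Commute ⁅x, y⁆ y) (n : ℕ) :
    ⁅x, y ^ n⁆ = ⁅x, y⁆ ^ n := by
  have hc : x * y * x⁻¹ = ⁅x, y⁆ * y := by simp [commutatorElement_def]
  rw [commutatorElement_def, ← conj_pow, hc, h.mul_pow, mul_inv_cancel_right]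

theorem commutatorElement_pow_left {x y : G} (h : Commute ⁅x, y⁆ x) (n : ℕ) :
    ⁅x ^ n, y⁆ = ⁅x, y⁆ ^ n := by
  have hc : y * x⁻¹ * y⁻¹ = x⁻¹ * ⁅x, y⁆ := by simp [commutatorElement_def, mul_assoc]
  have h1 : ⁅x ^ n, y⁆ = x ^ n * (y * x⁻¹ * y⁻¹) ^ n := by
    rw [conj_pow, inv_pow, commutatorElement_def]
    group
  rw [h1, hc, h.symm.inv_left.mul_pow, inv_pow, mul_inv_cancel_left]

end Commutator

/-! ### Bounded exponents in compact groups -/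

section NoSmallPowers

variable {G : Type*} [TopologicalSpace G] [Group G] [IsTopologicalGroup G]

/-- In a group without small powers, the identity is isolated among the elements of exponent
dividing `m`. -/
theorem HasNoSmallPowers.eventually_eq_one_of_pow_eq_one (hG : HasNoSmallPowers G) {m : ℕ}
    (hm : 0 < m) : ∀ᶠ z in 𝓝 (1 : G), z ^ m = 1 → z = 1 := by
  obtain ⟨V, hV, hVG⟩ := hG
  have h : ∀ᶠ z in 𝓝 (1 : G), ∀ i ∈ Finset.range m, z ^ i ∈ V := by
    rw [Finset.eventually_all]
    intro i _
    exact (continuous_pow i).continuousAt.eventually (by simpa using hV)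
  filter_upwards [h] with z hz hzm
  refine hVG z fun n => ?_
  rw [pow_eq_pow_mod n hzm]
  exact hz _ (Finset.mem_range.mpr (Nat.mod_lt n hm))

/-- A continuous map from a preconnected set to a group without small powers that takes the value
`1` and only values of bounded exponent is constant. -/
theorem HasNoSmallPowers.eq_one_of_isPreconnected [T1Space G] (hG : HasNoSmallPowers G)
    {X : Type*} [TopologicalSpace X] {C : Set X} (hC : IsPreconnected C) {f : X → G}
    (hf : Continuous f) {x₀ : X} (hx₀ : x₀ ∈ C) (hfx₀ : f x₀ = 1) {m : ℕ} (hm : 0 < m)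
    (hpow : ∀ x ∈ C, f x ^ m = 1) {x : X} (hx : x ∈ C) : f x = 1 := by
  obtain ⟨W, hW, hWo, hW1⟩ := eventually_nhds_iff.mp (hG.eventually_eq_one_of_pow_eq_one hm)
  by_contra hne
  obtain ⟨y, hyC, hyW, hy1⟩ := hC (f ⁻¹' W) (f ⁻¹' {1}ᶜ) (hWo.preimage hf)
    (isOpen_compl_singleton.preimage hf)
    (fun y _ => by
      by_cases h : f y = 1
      · exact Or.inl (by simpa [h] using hW1)
      · exact Or.inr h)
    ⟨x₀, hx₀, by simpa [hfx₀] using hW1⟩ ⟨x, hx, hne⟩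
  exact hy1 (hW _ hyW (hpow y hyC))

/-- In a compact group, every neighbourhood `U` of `1` admits a uniform `m > 0` such that every
element has a power `x ^ n ∈ U` with `n > 0` dividing `m`. -/
theorem exists_pos_forall_exists_dvd_pow_mem [CompactSpace G] {U : Set G} (hU : U ∈ 𝓝 (1 : G)) :
    ∃ m : ℕ, 0 < m ∧ ∀ x : G, ∃ n : ℕ, 0 < n ∧ n ∣ m ∧ x ^ n ∈ U := by
  obtain ⟨t, ht⟩ := isCompact_univ.elim_finite_subcover
    (fun n : ℕ => (fun x : G => x ^ (n + 1)) ⁻¹' interior U)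
    (fun n => isOpen_interior.preimage (continuous_pow _)) (fun x _ => by
      -- By compactness the powers of `x` cluster at `1`; asking for an exponent at least `1` keeps
      -- it positive.
      have h := (mapClusterPt_one_atTop_pow x).frequently (interior_mem_nhds.mpr hU)
      obtain ⟨n, hn, hxn⟩ := frequently_atTop.mp h 1
      refine Set.mem_iUnion.mpr ⟨n - 1, ?_⟩
      rw [Set.mem_preimage, Nat.sub_add_cancel hn]
      exact hxn)
  refine ⟨∏ n ∈ t, (n + 1), Finset.prod_pos fun n _ => n.succ_pos, fun x => ?_⟩
  obtain ⟨n, hn, hxn⟩ := Set.mem_iUnion₂.mp (ht (Set.mem_univ x))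
  exact ⟨n + 1, n.succ_pos, Finset.dvd_prod_of_mem _ hn, interior_subset hxn⟩

/-- In a compact group without small powers, the commutators that commute with both of their
entries have bounded exponent. -/
theorem HasNoSmallPowers.exists_commutatorElement_pow_eq_one [CompactSpace G]
    (hG : HasNoSmallPowers G) :
    ∃ m : ℕ, 0 < m ∧ ∀ x y : G, Commute ⁅x, y⁆ x → Commute ⁅x, y⁆ y → ⁅x, y⁆ ^ m = 1 := by
  obtain ⟨V, hV, hVG⟩ := hG
  -- Tube lemma: `⁅1, y⁆ = 1`, so one neighbourhood of `1` serves all `y` in the compact group.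
  have hU : ∀ᶠ x in 𝓝 (1 : G), ∀ y ∈ Set.univ, ⁅x, y⁆ ∈ V := by
    refine isCompact_univ.eventually_forall_of_forall_eventually fun y _ => ?_
    have hc : Continuous fun p : G × G => ⁅p.1, p.2⁆ := by
      simp only [commutatorElement_def]
      fun_prop
    exact hc.continuousAt.eventually (by simpa using hV)
  obtain ⟨m, hm, hmU⟩ := exists_pos_forall_exists_dvd_pow_mem hU
  refine ⟨m, hm, fun x y hx hy => ?_⟩
  obtain ⟨n, -, ⟨k, rfl⟩, hn⟩ := hmU x
  have hz : ⁅x, y⁆ ^ n = 1 := hVG _ fun j => by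
    rw [← commutatorElement_pow_left hx n, ← commutatorElement_pow_right]
    · exact hn _ (Set.mem_univ _)
    · rw [commutatorElement_pow_left hx n]
      exact hy.pow_left n
  rw [pow_mul, hz, one_pow]

end NoSmallPowers

/-! ### Representation spaces and their trivial components -/

namespace RepSpace

variable {Γ Δ K : Type*} [Group Γ] [Group Δ] [Group K]

theorem one_apply (γ : Γ) : (1 : RepSpace Γ K) γ = 1 := rfl

@[ext]
theorem ext {ρ σ : RepSpace Γ K} (h : ∀ γ, ρ γ = σ γ) : ρ = σ := DFunLike.ext ρ σ h

/-- Precomposition with a group homomorphism. -/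
def precomp (q : Γ →* Δ) (σ : RepSpace Δ K) : RepSpace Γ K :=
  MonoidHom.comp (show Δ →* K from σ) q

theorem mem_range_precomp {q : Γ →* Δ} (hq : Function.Surjective q) {ρ : RepSpace Γ K}
    (h : ∀ γ, q γ = 1 → ρ γ = 1) : ρ ∈ Set.range (precomp q : RepSpace Δ K → RepSpace Γ K) := by
  let ρ' : Γ →* K := ρ
  refine ⟨q.liftOfSurjective hq ⟨ρ', fun γ hγ => h γ hγ⟩, ext fun γ => ?_⟩
  exact q.liftOfRightInverse_comp_apply _ (Function.rightInverse_surjInv hq) _ γ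

variable [TopologicalSpace K]

theorem continuous_eval (γ : Γ) : Continuous fun ρ : RepSpace Γ K => ρ γ :=
  (continuous_apply γ).comp continuous_induced_dom

theorem continuous_iff {X : Type*} [TopologicalSpace X] {f : X → RepSpace Γ K} :
    Continuous f ↔ ∀ γ, Continuous fun x => f x γ :=
  continuous_induced_rng.trans continuous_pi_iff

theorem isEmbedding_precomp {q : Γ →* Δ} (hq : Function.Surjective q) :
    IsEmbedding (precomp q : RepSpace Δ K → RepSpace Γ K) := by
  refine ⟨⟨?_⟩, fun σ τ h => ext fun δ => ?_⟩
  · refine le_antisymm (Continuous.le_induced (continuous_iff.mpr fun γ => continuous_eval _)) ?_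
    let t : TopologicalSpace (RepSpace Δ K) :=
      TopologicalSpace.induced (precomp q) inferInstance
    refine continuous_iff_le_induced.mp (continuous_pi fun δ => ?_)
    obtain ⟨γ, rfl⟩ := hq δ
    exact (continuous_eval γ).comp (continuous_induced_dom (f := precomp (K := K) q))
  · obtain ⟨γ, rfl⟩ := hq δ
    exact DFunLike.congr_fun h γ

/-- The component for `Γ` lies in the range of an embedding, so its preimage is connected and
contains `1`; this gives the inclusion that continuity alone does not. -/
theorem image_precomp_trivialComponent {q : Γ →* Δ} (hq : Function.Surjective q)
    (h : ∀ ρ ∈ trivialComponent Γ K, ∀ γ, q γ = 1 → ρ γ = 1) :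
    precomp q '' trivialComponent Δ K = trivialComponent Γ K := by
  have he := isEmbedding_precomp (K := K) hq
  have hr : trivialComponent Γ K ⊆ Set.range (precomp q) :=
    fun ρ hρ => mem_range_precomp hq (h ρ hρ)
  refine Set.Subset.antisymm (he.continuous.image_connectedComponent_subset 1) ?_
  rw [← Set.image_preimage_eq_of_subset hr]
  refine Set.image_mono (IsPreconnected.subset_connectedComponent ?_ ?_)
  · rw [← he.isInducing.isPreconnected_image, Set.image_preimage_eq_of_subset hr]
    exact isPreconnected_connectedComponent
  · exact mem_connectedComponent

/-- If every representation in the trivial component factors through a quotient, then the trivial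
component is that of the quotient. -/
theorem nonempty_homeomorph_trivialComponent {q : Γ →* Δ} (hq : Function.Surjective q)
    (h : ∀ ρ ∈ trivialComponent Γ K, ∀ γ, q γ = 1 → ρ γ = 1) :
    Nonempty (trivialComponent Γ K ≃ₜ trivialComponent Δ K) :=
  ⟨(((isEmbedding_precomp hq).homeomorphImage _).trans
    (Homeomorph.setCongr (image_precomp_trivialComponent hq h))).symm⟩

variable [IsTopologicalGroup K] [T1Space K]

theorem eq_one_of_forall_pow_eq_one (hK : HasNoSmallPowers K) {γ : Γ} {m : ℕ} (hm : 0 < m)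
    (h : ∀ ρ ∈ trivialComponent Γ K, ρ γ ^ m = 1) :
    ∀ ρ ∈ trivialComponent Γ K, ρ γ = 1 := fun _ hρ =>
  hK.eq_one_of_isPreconnected isPreconnected_connectedComponent (continuous_eval γ)
    mem_connectedComponent (one_apply γ) hm h hρ

/-- For `Γ` nilpotent, representations in the trivial component kill `[Γ, Γ]`. -/
theorem eq_one_of_mem_commutator [CompactSpace K] [Group.IsNilpotent Γ] (hK : HasNoSmallPowers K) :
    ∀ γ ∈ commutator Γ, ∀ ρ ∈ trivialComponent Γ K, ρ γ = 1 := by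
  obtain ⟨m, hm, hcomm⟩ := hK.exists_commutatorElement_pow_eq_one
  obtain ⟨c, hc⟩ := Subgroup.nilpotent_iff_lowerCentralSeries.mp ‹Group.IsNilpotent Γ›
  -- Here `k = 0` is a term below the trivial one, and `k = c` is term `1`, the commutator subgroup.
  have key : ∀ k, k ≤ c → ∀ γ ∈ (⊤ : Subgroup Γ).lowerCentralSeries (c - k + 1),
      ∀ ρ ∈ trivialComponent Γ K, ρ γ = 1 := by
    intro k
    induction k with
    | zero =>
      intro _ γ hγ ρ _
      have : γ ∈ (⊤ : Subgroup Γ).lowerCentralSeries c :=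
        Subgroup.lowerCentralSeries_antitone _ (by omega) hγ
      rw [hc, Subgroup.mem_bot] at this
      rw [this, map_one]
    | succ k ih =>
      intro hk γ hγ ρ hρ
      have ih := ih (by omega)
      rw [show c - k + 1 = (c - (k + 1) + 1) + 1 by omega] at ih
      generalize c - (k + 1) = j at ih hγ
      have hle : (⊤ : Subgroup Γ).lowerCentralSeries (j + 1) ≤
          (show Γ →* K from ρ).ker := by
        rw [Subgroup.lowerCentralSeries_succ, Subgroup.commutator_le]
        intro y hy x _
        have hyx : ⁅y, x⁆ ∈ (⊤ : Subgroup Γ).lowerCentralSeries (j + 1) :=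
          Subgroup.commutator_mem_commutator hy (Subgroup.mem_top x)
        refine eq_one_of_forall_pow_eq_one hK hm (fun σ hσ => ?_) ρ hρ
        -- Every `σ` in the component kills the next term of the series, so `⁅σ y, σ x⁆` is central
        -- in the image of `σ`.
        have hcen : ∀ g : Γ, Commute ⁅σ y, σ x⁆ (σ g) := fun g => by
          rw [← map_commutatorElement, ← commutatorElement_eq_one_iff_commute,
            ← map_commutatorElement]
          exact ih _ (Subgroup.commutator_mem_commutator hyx (Subgroup.mem_top g)) σ hσ
        rw [map_commutatorElement]
        exact hcomm _ _ (hcen y) (hcen x)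
      exact hle hγ
  intro γ hγ
  refine key c le_rfl γ ?_
  rwa [Nat.sub_self, zero_add, Subgroup.top_lowerCentralSeries_one]

/-- For `Γ` nilpotent, representations in the trivial component kill the elements whose image in
the abelianization has finite order. -/
theorem eq_one_of_isOfFinOrder_abelianization [CompactSpace K] [Group.IsNilpotent Γ]
    (hK : HasNoSmallPowers K) {γ : Γ} (hγ : IsOfFinOrder (Abelianization.of γ)) :
    ∀ ρ ∈ trivialComponent Γ K, ρ γ = 1 := by
  obtain ⟨m, hm, hγm⟩ := isOfFinOrder_iff_pow_eq_one.mp hγ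
  refine eq_one_of_forall_pow_eq_one hK hm fun ρ hρ => ?_
  rw [← map_pow]
  refine eq_one_of_mem_commutator hK _ ?_ ρ hρ
  rw [← Abelianization.ker_of Γ, MonoidHom.mem_ker, map_pow, hγm]

end RepSpace

/-- A finitely generated abelian group of rank `r` maps onto `ℤ ^ r` with torsion kernel. -/
theorem exists_surjective_addMonoidHom_fin_finrank (A : Type*) [AddCommGroup A]
    [Module.Finite ℤ A] :
    ∃ f : A →+ (Fin (Module.finrank ℤ A) → ℤ), Function.Surjective f ∧
      ∀ a, f a = 0 → IsOfFinAddOrder a := by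
  let b := Module.finBasisOfFinrankEq ℤ (A ⧸ Submodule.torsion ℤ A)
    (finrank_quotient_eq_of_le_torsion le_rfl)
  refine ⟨(b.equivFun.toLinearMap ∘ₗ (Submodule.torsion ℤ A).mkQ).toAddMonoidHom,
    b.equivFun.surjective.comp (Submodule.mkQ_surjective _), fun a ha => ?_⟩
  have h : b.equivFun ((Submodule.torsion ℤ A).mkQ a) = 0 := ha
  rw [map_eq_zero_iff _ b.equivFun.injective, Submodule.mkQ_apply,
    Submodule.Quotient.mk_eq_zero, Submodule.mem_torsion_iff] at h
  obtain ⟨n, hn⟩ := h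
  have hn0 : (n : ℤ) ≠ 0 := nonZeroDivisors.coe_ne_zero n
  have hna : (n : ℤ) • a = 0 := hn
  exact isOfFinAddOrder_iff_zsmul_eq_zero.mpr ⟨n, hn0, hna⟩

theorem corollary3p2
    -- `K` is a (possibly disconnected) compact Lie group
    {E : Type*} [NormedAddCommGroup E] [NormedSpace ℝ E] [FiniteDimensional ℝ E]
    {K : Type*} [TopologicalSpace K] [ChartedSpace E K] [Group K] [LieGroup 𝓘(ℝ, E) ∞ K]
    [T2Space K] [CompactSpace K]
    -- `Γ` is a finitely generated nilpotent group
    {Γ : Type*} [Group Γ] [Group.FG Γ] [Group.IsNilpotent Γ] :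
    Nonempty (RepSpace.trivialComponent Γ K ≃ₜ
      RepSpace.trivialComponent
        (Multiplicative (Fin (Module.finrank ℤ (IntegralH1 Γ)) → ℤ)) K) ∧
    -- the torsion part of `H₁(Γ; ℤ)` acts trivially on the component of the trivial representation
    (∀ ρ ∈ RepSpace.trivialComponent Γ K, ∀ γ : Γ,
      IsOfFinAddOrder (Additive.ofMul (Abelianization.of γ) : IntegralH1 Γ) → ρ γ = 1) := by
  have : IsTopologicalGroup K := topologicalGroup_of_lieGroup 𝓘(ℝ, E) ∞
  have hK : HasNoSmallPowers K := hasNoSmallPowers_of_lieGroup E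
  have htor : ∀ ρ ∈ RepSpace.trivialComponent Γ K, ∀ γ : Γ,
      IsOfFinAddOrder (Additive.ofMul (Abelianization.of γ) : IntegralH1 Γ) → ρ γ = 1 :=
    fun ρ hρ γ hγ => RepSpace.eq_one_of_isOfFinOrder_abelianization hK
      (isOfFinAddOrder_ofMul_iff.mp hγ) ρ hρ
  refine ⟨?_, htor⟩
  have : Module.Finite ℤ (IntegralH1 Γ) := by
    have : Group.FG (Abelianization Γ) := QuotientGroup.fg _
    exact Module.Finite.iff_addGroup_fg.mpr inferInstance
  obtain ⟨f, hf, hker⟩ := exists_surjective_addMonoidHom_fin_finrank (IntegralH1 Γ)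
  refine RepSpace.nonempty_homeomorph_trivialComponent
    (q := (AddMonoidHom.toMultiplicativeRight f).comp Abelianization.of) ?_ ?_
  · exact hf.comp QuotientGroup.mk_surjective
  · exact fun ρ hρ γ hγ => htor ρ hρ γ (hker _ hγ)
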